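/- All graphs are finite and simple. For a graph $G$, let $N_r(G)$ be the number of cliques of size $r$ in $G$. A $k$-factor of $G$ is a $k$-regular spanning subgraph of $G$. The $l$-closure $C_l(G)$ is the graph obtained from $G$ by successively joining pairs of nonadjacent vertices whose degree sum is at least $l$, until no such pair exists. $K_m$ is the complete graph on $m$ vertices, $I_m$ the graph with $m$ vertices and no edges, $G_1+G_2$ the disjoint union of $G_1$ and $G_2$, and $G_1\vee G_2$ their join. Put $$\varphi(n,r,q)=\binom{n-q-1}{r}+(q+1)\binom{q}{r-1},\qquad \phi(n,r,k,q)=\binom{n-q+2k-4}{r}+(q-2k+4)\binom{q}{r-1}.$$ **Theorem.** Let $r\ge 2$, $k\ge 1$ and $\delta\ge 0$ be integers, and let $G$ be a graph of order $n\ge 2\delta+k+1$ with $nk$ even and minimum degree at least $\delta$. (i) Suppose that $n$ is even (which is automatic for $k=1$), that $1\le\delta\le\frac n2-1$, and that $N_r(G)>\max\{\varphi(n,r,\delta+1),\ \varphi(n,r,\frac n2-1)\}$. Then $G$ has a $1$-factor unless either $\delta$ is even and $C_{n-1}(G)\cong K_{n-\delta-1}+K_{\delta+1}$, or $C_{n-1}(G)\cong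 K_\delta\vee(K_{n-2\delta-1}+I_{\delta+1})$; in these exceptional cases $G$ has no $1$-factor. (ii) Suppose that $k\ge 2$, that $2k-2\le\delta\le\lfloor\frac{n+2k-5}{2}\rfloor$, and that $N_r(G)>\max\{\phi(n,r,k,\delta+1),\ \phi(n,r,k,\lfloor\frac{n+2k-5}{2}\rfloor)\}$. Then $G$ has a $k$-factor. -/

import Mathlib

namespace KFactor

/-- `G` has a `k`-factor: a `k`-regular spanning subgraph. -/
def HasFactor {V : Type*} (G : SimpleGraph V) (k : ℕ) : Prop :=
  ∃ F : SimpleGraph V, F ≤ G ∧ ∃ _ : F.LocallyFinite, F.IsRegularOfDegree k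

/-- The join of two vertex-disjoint graphs. -/
def graphJoin {V W : Type*} (G : SimpleGraph V) (H : SimpleGraph W) : SimpleGraph (V ⊕ W) :=
  (G ⊕g H) ⊔ completeBipartiteGraph V W

open Classical in
/-- `H` arises from `G` by joining one pair of distinct nonadjacent vertices whose degree sum in
`G` is at least `l`. -/
def ClosureStep {V : Type*} [Fintype V] (l : ℕ) (G H : SimpleGraph V) : Prop :=
  ∃ u v : V, u ≠ v ∧ ¬ G.Adj u v ∧ l ≤ G.degree u + G.degree v ∧ H = G ⊔ SimpleGraph.edge u v

/-- `H` is obtained from `G` by successively joining nonadjacent pairs with degree sum at least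
`l`, until no such pair exists. -/
def IsClosureOf {V : Type*} [Fintype V] (l : ℕ) (G H : SimpleGraph V) : Prop :=
  Relation.ReflTransGen (ClosureStep l) G H ∧ ∀ H', ¬ ClosureStep l H H'

theorem exists_isClosureOf {V : Type*} [Fintype V] (l : ℕ) (G : SimpleGraph V) :
    ∃ H, IsClosureOf l G H := by
  induction G using WellFoundedGT.induction with
  | ind G ih =>
    by_cases h : ∃ H, ClosureStep l G H
    · obtain ⟨H, hH⟩ := h
      have hlt : H > G := by
        obtain ⟨u, v, huv, hadj, -, rfl⟩ := hH
        exact SimpleGraph.lt_sup_edge _ _ _ huv hadj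
      obtain ⟨K, hK, hK'⟩ := ih H hlt
      exact ⟨K, Relation.ReflTransGen.head hH hK, hK'⟩
    · exact ⟨G, Relation.ReflTransGen.refl, fun H hH => h ⟨H, hH⟩⟩

/-- The result does not depend on the order in which the pairs are joined. -/
theorem IsClosureOf.unique {V : Type*} [Fintype V] {l : ℕ} {G H K : SimpleGraph V}
    (hH : IsClosureOf l G H) (hK : IsClosureOf l G K) : H = K := by
  classical
  have base : ∀ {A B : SimpleGraph V}, Relation.ReflTransGen (ClosureStep l) A B → A ≤ B := by
    intro A B h
    induction h with
    | refl => exact le_rfl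
    | tail _ hs ih =>
      obtain ⟨u, v, -, -, -, rfl⟩ := hs
      exact ih.trans le_sup_left
  have key : ∀ {A B C : SimpleGraph V}, Relation.ReflTransGen (ClosureStep l) A B →
      A ≤ C → (∀ C', ¬ ClosureStep l C C') → B ≤ C := by
    intro A B C h hAC hC
    induction h with
    | refl => exact hAC
    | tail _ hs ih =>
      obtain ⟨u, v, huv, -, hdeg, rfl⟩ := hs
      have hadj : C.Adj u v := by
        by_contra hn
        refine hC _ ⟨u, v, huv, hn, hdeg.trans (Nat.add_le_add ?_ ?_), rfl⟩
        · convert SimpleGraph.degree_le_of_le ih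
        · convert SimpleGraph.degree_le_of_le ih
      refine sup_le ih fun a b hab => ?_
      rw [SimpleGraph.edge_adj] at hab
      rcases hab.1 with ⟨rfl, rfl⟩ | ⟨rfl, rfl⟩
      · exact hadj
      · exact hadj.symm
  exact le_antisymm (key hH.1 (base hK.1) hK.2) (key hK.1 (base hH.1) hH.2)

/-- The `l`-closure `C_l(G)`. -/
noncomputable def lClosure {V : Type*} [Fintype V] (l : ℕ) (G : SimpleGraph V) : SimpleGraph V :=
  Classical.choose (exists_isClosureOf l G)

theorem lClosure_spec {V : Type*} [Fintype V] (l : ℕ) (G : SimpleGraph V) :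
    IsClosureOf l G (lClosure l G) :=
  Classical.choose_spec (exists_isClosureOf l G)

/-- `φ(n,r,q) = C(n-q-1, r) + (q+1) C(q, r-1)`, used for `q + 1 ≤ n` and `1 ≤ r`. -/
def phiOne (n r q : ℕ) : ℕ :=
  (n - q - 1).choose r + (q + 1) * q.choose (r - 1)

/-- `ϕ(n,r,k,q) = C(n-q+2k-4, r) + (q-2k+4) C(q, r-1)`, with the subtractions arranged so that
none of them truncates for `2k - 4 ≤ q ≤ n + 2k - 4` and `1 ≤ r`. -/
def phiTwo (n r k q : ℕ) : ℕ :=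
  (n + 2 * k - 4 - q).choose r + (q + 4 - 2 * k) * q.choose (r - 1)

/-- The disjoint union of `K_{n-δ-1}` and `K_{δ+1}`. -/
abbrev exceptionalUnion (n δ : ℕ) : SimpleGraph (Fin (n - δ - 1) ⊕ Fin (δ + 1)) :=
  SimpleGraph.completeGraph (Fin (n - δ - 1)) ⊕g SimpleGraph.completeGraph (Fin (δ + 1))

/-- `K_δ ∨ (K_{n-2δ-1} + I_{δ+1})`. -/
abbrev exceptionalJoin (n δ : ℕ) :
    SimpleGraph (Fin δ ⊕ (Fin (n - 2 * δ - 1) ⊕ Fin (δ + 1))) :=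
  graphJoin (SimpleGraph.completeGraph (Fin δ))
    (SimpleGraph.completeGraph (Fin (n - 2 * δ - 1)) ⊕g SimpleGraph.emptyGraph (Fin (δ + 1)))

end KFactor

/-! Put `c = 2 * k - 3` in natural subtraction, so `c = 0` for `k = 1`. The closure joins
nonadjacent pairs of degree sum at least `n - 1 + c`, and by `hasFactor_of_sup_edge` each such step
preserves the absence of a `k`-factor. So it suffices to treat the closure `H`, where nonadjacent
vertices have degree sum at most `n - 2 + c`.

If `H` is complete, it has a `k`-factor (`hasFactor_top`). Otherwise the clique count forces its
shape (`exists_isSplit`). A graph with `q + 1 - c` vertices of degree at most `q` has at most `bnd n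
r c q` cliques of size `r`. This bound is convex in `q`, so exceeding it at both ends of the range
excludes every `q` between. What survives is a set `L` of `δ + 1 - c` vertices of degree `δ`, the
rest being a clique `A ∪ B` with `A` joined completely to `L` and `B` not at all.

A `k`-factor of such a graph is built in two stages. Among the subgraphs of maximum degree at most
`k` whose edges meet `L`, one with the largest degree sum on `L` saturates `L`: a count of the edges
between `A` and `L`, followed by an exchange of edges, rules out an unsaturated vertex
(`IsOpt.saturated_of_two_le`, `IsOpt.saturated_one`). It is then completed inside the clique
(`hasFactor_of_partial`). Saturation can fail only for `k = 1`, with `A` empty and `L` odd, or with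
`A` of size `δ`. These are the two exceptional graphs. -/

namespace KFactor

open Finset SimpleGraph

/-! ### Edge exchanges, and stability of `k`-factors under the closure. -/

section

variable {V : Type*}

/-- Replace the edge `xy` by the edge `ux`. -/
def shift (M : SimpleGraph V) (u x y : V) : SimpleGraph V := (M \ edge x y) ⊔ edge u x

lemma shift_adj {M : SimpleGraph V} {u x y a b : V} (hxy : M.Adj x y) (hux : u ≠ x) :
    (shift M u x y).Adj a b ↔
      (M.Adj a b ∧ ¬ (a = x ∧ b = y) ∧ ¬ (a = y ∧ b = x)) ∨ (a = u ∧ b = x) ∨ (a = x ∧ b = u) := by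
  have := hxy.ne
  simp only [shift, sup_adj, sdiff_adj, edge_adj]
  grind [SimpleGraph.irrefl]

lemma shift_le {M G : SimpleGraph V} {u x y : V} (hM : M ≤ G) (h : G.Adj u x) :
    shift M u x y ≤ G :=
  sup_le (sdiff_le.trans hM) ((edge_le_iff _).2 (Or.inr h))

lemma sup_edge_le {M G : SimpleGraph V} {a b : V} (hM : M ≤ G) (h : G.Adj a b) :
    M ⊔ edge a b ≤ G :=
  sup_le hM ((edge_le_iff _).2 (Or.inr h))

variable [Fintype V]

open Classical in
/-- The neighbours of `v` as a finset. -/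
noncomputable def nb (M : SimpleGraph V) (v : V) : Finset V := univ.filter (M.Adj v)

@[simp] lemma mem_nb {M : SimpleGraph V} {v w : V} : w ∈ nb M v ↔ M.Adj v w := by
  simp [nb]

/-- The degree of `v`, free of decidability instances. -/
noncomputable def dg (M : SimpleGraph V) (v : V) : ℕ := (nb M v).card

lemma degree_eq_dg (M : SimpleGraph V) (v : V) [Fintype (M.neighborSet v)] :
    M.degree v = dg M v := by
  rw [dg, ← card_neighborFinset_eq_degree]
  congr 1
  ext w
  simp

lemma nb_mono {M N : SimpleGraph V} (h : M ≤ N) (v : V) : nb M v ⊆ nb N v := by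
  intro w
  simp only [mem_nb]
  exact fun hw => h hw

lemma dg_mono {M N : SimpleGraph V} (h : M ≤ N) (v : V) : dg M v ≤ dg N v :=
  card_le_card (nb_mono h v)

lemma hasFactor_iff {G : SimpleGraph V} {k : ℕ} :
    HasFactor G k ↔ ∃ F ≤ G, ∀ v, dg F v = k := by
  classical
  constructor
  · rintro ⟨F, hF, hl, hr⟩
    refine ⟨F, hF, fun v => ?_⟩
    rw [← degree_eq_dg]
    exact hr v
  · rintro ⟨F, hF, hr⟩
    refine ⟨F, hF, fun v => inferInstance, fun v => ?_⟩
    rw [degree_eq_dg]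
    exact hr v

lemma le_lClosure (l : ℕ) (G : SimpleGraph V) : G ≤ lClosure l G := by
  have h := (lClosure_spec l G).1
  generalize lClosure l G = H at h
  induction h with
  | refl => exact le_rfl
  | tail _ hs ih =>
    obtain ⟨u, v, -, -, -, rfl⟩ := hs
    exact ih.trans le_sup_left

lemma lClosure_closed {l : ℕ} {G : SimpleGraph V} {u v : V} (huv : u ≠ v)
    (h : ¬ (lClosure l G).Adj u v) : dg (lClosure l G) u + dg (lClosure l G) v < l := by
  classical
  by_contra hl
  refine (lClosure_spec l G).2 _ ⟨u, v, huv, h, ?_, rfl⟩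
  rw [degree_eq_dg, degree_eq_dg]
  omega

variable [DecidableEq V]

/-- Double counting of the edges between two sets of vertices. -/
lemma sum_card_nb_inter (M : SimpleGraph V) (A B : Finset V) :
    ∑ x ∈ A, (nb M x ∩ B).card = ∑ y ∈ B, (nb M y ∩ A).card := by
  have e : ∀ (x : V) (C : Finset V), (nb M x ∩ C).card = ∑ y ∈ C, if y ∈ nb M x then 1 else 0 := by
    intro x C
    rw [inter_comm, ← filter_mem_eq_inter, card_filter]
  rw [sum_congr rfl fun x _ => e x B, sum_congr rfl fun y _ => e y A, sum_comm]
  refine sum_congr rfl fun y _ => sum_congr rfl fun x _ => ?_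
  exact if_congr (by rw [mem_nb, mem_nb, M.adj_comm]) rfl rfl

lemma dg_sup_edge {M : SimpleGraph V} {a b : V} (hab : a ≠ b) (h : ¬ M.Adj a b) (w : V) :
    dg (M ⊔ edge a b) w = dg M w + (if w = a then 1 else 0) + (if w = b then 1 else 0) := by
  have hb : b ∉ nb M a := by simpa using h
  have ha : a ∉ nb M b := by simpa using fun h' : M.Adj b a => h h'.symm
  rcases eq_or_ne w a with rfl | hwa
  · have : nb (M ⊔ edge w b) w = insert b (nb M w) := by
      ext y
      simp only [mem_nb, sup_adj, edge_adj, mem_insert]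
      grind
    simp [dg, this, hb, hab]
  · rcases eq_or_ne w b with rfl | hwb
    · have : nb (M ⊔ edge a w) w = insert a (nb M w) := by
        ext y
        simp only [mem_nb, sup_adj, edge_adj, mem_insert]
        grind
      simp [dg, this, ha, hwa]
    · have : nb (M ⊔ edge a b) w = nb M w := by
        ext y
        simp only [mem_nb, sup_adj, edge_adj]
        grind
      simp [dg, this, hwa, hwb]

lemma dg_sdiff_edge {M : SimpleGraph V} {a b : V} (h : M.Adj a b) (w : V) :
    dg (M \ edge a b) w + (if w = a then 1 else 0) + (if w = b then 1 else 0) = dg M w := by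
  have h1 : ¬ (M \ edge a b).Adj a b := by
    simp [sdiff_adj, edge_adj, h.ne]
  rw [← dg_sup_edge h.ne h1, sdiff_sup_cancel]
  exact (edge_le_iff _).2 (Or.inr h)

lemma dg_shift {M : SimpleGraph V} {u x y : V} (hxy : M.Adj x y) (hux : u ≠ x)
    (h : ¬ M.Adj u x) (w : V) :
    dg (shift M u x y) w + (if w = y then 1 else 0) = dg M w + (if w = u then 1 else 0) := by
  have h1 : ¬ (M \ edge x y).Adj u x := fun h' => h h'.1
  have := dg_sup_edge hux h1 w
  have := dg_sdiff_edge hxy w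
  unfold shift
  omega

/-- A graph all of whose degrees are `k` but for two nonadjacent vertices of degree `k - 1` can be
completed to a `k`-factor when the degree sum of these two is large. -/
lemma hasFactor_of_near {G M : SimpleGraph V} {k : ℕ} (hk : 1 ≤ k) {u v : V} (huv : u ≠ v)
    (hG : ¬ G.Adj u v) (hM : M ≤ G) (hu : dg M u + 1 = k) (hv : dg M v + 1 = k)
    (hd : ∀ w, w ≠ u → w ≠ v → dg M w = k)
    (hsum : Fintype.card V - 1 + (2 * k - 3) ≤ dg G u + dg G v) : HasFactor G k := by
  by_contra hno
  have hG' : ¬ G.Adj v u := fun h => hG h.symm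
  set P := nb G u \ nb M u with hP
  set Q := nb G v \ nb M v with hQ
  have memP : ∀ x, x ∈ P ↔ G.Adj u x ∧ ¬ M.Adj u x := by simp [hP]
  have memQ : ∀ x, x ∈ Q ↔ G.Adj v x ∧ ¬ M.Adj v x := by simp [hQ]
  have cardP : P.card + dg M u = dg G u := by
    rw [hP, card_sdiff_of_subset (nb_mono hM u)]
    exact Nat.sub_add_cancel (dg_mono hM u)
  have cardQ : Q.card + dg M v = dg G v := by
    rw [hQ, card_sdiff_of_subset (nb_mono hM v)]
    exact Nat.sub_add_cancel (dg_mono hM v)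
  -- An `M`-edge `xy` from `P` to `Q` could be traded for `ux` and `yv`, giving a `k`-factor.
  have noPQ : ∀ x ∈ P, ∀ y ∈ Q, ¬ M.Adj x y := by
    intro x hx y hy hxy
    rw [memP] at hx
    rw [memQ] at hy
    have hyv : y ≠ v := hy.1.ne'
    have hyu : y ≠ u := fun h => hG' (h ▸ hy.1)
    have h1 : ¬ (shift M u x y).Adj y v := by
      rw [shift_adj hxy hx.1.ne]
      have := hy.2
      have : ¬ M.Adj y v := fun h => this h.symm
      have : v ≠ x := fun h => hG (h ▸ hx.1)
      grind
    refine hno (hasFactor_iff.2 ⟨shift M u x y ⊔ edge y v,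
      sup_edge_le (shift_le hM hx.1) hy.1.symm, fun w => ?_⟩)
    have e1 := dg_shift hxy hx.1.ne hx.2 w
    have e2 := dg_sup_edge hyv h1 w
    have := hd w
    grind
  set Q' := ((univ \ Q).erase u).erase v with hQ'
  have memQ' : ∀ x, x ∈ Q' ↔ x ≠ u ∧ x ≠ v ∧ x ∉ Q := by simp [hQ']; tauto
  have cardQ' : Q'.card + Q.card + 2 = Fintype.card V := by
    have h1 : (univ \ Q).card + Q.card = Fintype.card V := by
      rw [card_sdiff_add_card_eq_card (subset_univ Q), card_univ]
    have hu' : u ∈ univ \ Q := by simp [memQ, hG']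
    have hv' : v ∈ (univ \ Q).erase u := by simp [memQ, huv.symm]
    have e1 := card_erase_add_one hu'
    have e2 := card_erase_add_one hv'
    rw [← hQ'] at e2
    omega
  have huP : u ∉ P := by simp [memP]
  have hvP : v ∉ P := by simp [memP, hG]
  -- double counting of the edges between `P ∪ {u, v}` and `Q'`
  set R := insert u (insert v P) with hR
  have dbl := sum_card_nb_inter M R Q'
  have hQk : ∀ y ∈ Q', (nb M y ∩ R).card ≤ k := by
    intro y hy
    rw [memQ'] at hy
    rw [← hd y hy.1 hy.2.1]
    exact card_le_card inter_subset_left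
  have hub : ∑ y ∈ Q', (nb M y ∩ R).card ≤ k * Q'.card := by
    rw [mul_comm]
    exact sum_le_card_nsmul _ _ _ hQk
  have hvQ' : nb M v ⊆ Q' := by
    intro y hy
    rw [mem_nb] at hy
    rw [memQ', memQ]
    exact ⟨fun h => hG' (h ▸ hM hy), hy.ne', fun h => h.2 hy⟩
  have hlb : k * P.card ≤ ∑ x ∈ P, (nb M x ∩ Q').card + (P ∩ nb M v).card := by
    have e : (P ∩ nb M v).card = ∑ x ∈ P, if x ∈ nb M v then 1 else 0 := by
      rw [← filter_mem_eq_inter, card_filter]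
    rw [e, ← sum_add_distrib, mul_comm]
    refine card_nsmul_le_sum _ _ _ fun x hx => ?_
    have hxu : x ≠ u := fun h => huP (h ▸ hx)
    have hxv : x ≠ v := fun h => hvP (h ▸ hx)
    rw [← hd x hxu hxv]
    have hsub : nb M x ⊆ (nb M x ∩ Q') ∪ (if x ∈ nb M v then {v} else ∅) := by
      intro y hy
      have h1 : y ∉ Q := fun h => noPQ x hx y h (mem_nb.1 hy)
      have h2 : y ≠ u := fun h => ((memP x).1 hx).2 (h ▸ mem_nb.1 hy).symm
      have h3 : y ∈ Q' ↔ y ≠ v := by rw [memQ']; tauto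
      have h4 : y = v → x ∈ nb M v := fun h => mem_nb.2 (h ▸ mem_nb.1 hy).symm
      grind
    refine (card_le_card hsub).trans ((card_union_le _ _).trans ?_)
    gcongr
    split_ifs <;> simp
  have hsplit : ∑ x ∈ R, (nb M x ∩ Q').card =
      (nb M u ∩ Q').card + (dg M v + ∑ x ∈ P, (nb M x ∩ Q').card) := by
    rw [hR, sum_insert (by simp [huv, huP]), sum_insert hvP, inter_eq_left.2 hvQ']
    rfl
  have hPv : (P ∩ nb M v).card ≤ dg M v := card_le_card inter_subset_right
  have hPQ : Q'.card ≤ P.card := by omega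
  have hmul : k * Q'.card ≤ k * P.card := Nat.mul_le_mul_left _ hPQ
  -- For `k = 1` the truncated threshold makes `Q'` strictly smaller than `P`, against the count.
  -- For `k ≥ 2` every inequality in the count is an equality: `u` has no `M`-neighbour in `Q'`,
  -- those of `v` lie in `P`, and `Q'` sends `M`-edges only to `R`.
  rcases Nat.lt_or_ge k 2 with hk2 | hk2
  · have : k = 1 := by omega
    subst this
    omega
  have tu : (nb M u ∩ Q').card = 0 := by omega
  have tv : (P ∩ nb M v).card = dg M v := by omega
  have hvP' : nb M v ⊆ P := by
    have := eq_of_subset_of_card_le (inter_subset_right : P ∩ nb M v ⊆ nb M v) tv.ge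
    exact inter_eq_right.1 this
  have tight : ∀ y ∈ Q', nb M y ⊆ R := by
    intro y hy
    have h1 : ∑ y ∈ Q', (nb M y ∩ R).card = ∑ y ∈ Q', k := by
      rw [sum_const, smul_eq_mul, mul_comm]
      omega
    have h2 := (sum_eq_sum_iff_of_le hQk).1 h1 y hy
    have hy' := (memQ' y).1 hy
    have h3 : nb M y ∩ R = nb M y := by
      refine eq_of_subset_of_card_le inter_subset_left ?_
      rw [h2, ← hd y hy'.1 hy'.2.1]
      rfl
    exact inter_eq_left.1 h3
  obtain ⟨z, hz⟩ : (nb M u).Nonempty := card_pos.1 (by change 0 < dg M u; omega)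
  obtain ⟨w, hw⟩ : (nb M v).Nonempty := card_pos.1 (by change 0 < dg M v; omega)
  have hwP := (memP w).1 (hvP' hw)
  have hwu : w ≠ u := hwP.1.ne'
  have hwv : w ≠ v := (mem_nb.1 hw).ne'
  obtain ⟨t, ht, htv⟩ : ∃ t ∈ nb M w, t ≠ v := by
    apply exists_mem_ne
    change 1 < dg M w
    rw [hd w hwu hwv]
    omega
  have hwt : M.Adj w t := mem_nb.1 ht
  have htu : t ≠ u := fun h => hwP.2 (h ▸ hwt.symm)
  have htP : t ∈ P := by
    have := tight w (hvQ' hw) ht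
    simpa [hR, htu, htv] using this
  have htP' := (memP t).1 htP
  have huz : M.Adj u z := mem_nb.1 hz
  have hzv : z ≠ v := fun h => hG (h ▸ hM huz)
  have hzQ : z ∈ Q := by
    by_contra h
    have : z ∈ nb M u ∩ Q' := mem_inter.2 ⟨hz, (memQ' z).2 ⟨huz.ne', hzv, h⟩⟩
    rw [card_eq_zero.1 tu] at this
    simp at this
  have hzQ' := (memQ z).1 hzQ
  have hzw : z ≠ w := fun h => hwP.2 (h ▸ huz)
  have hzt : z ≠ t := fun h => htP'.2 (h ▸ huz)
  have a1 : ∀ a b, (shift M v z u).Adj a b ↔ _ := fun a b => shift_adj huz.symm hzv.symm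
  have b1 : (shift M v z u).Adj t w := by
    rw [a1]
    have := hwt.symm
    grind
  have b2 : ¬ (shift M v z u).Adj u t := by
    rw [a1]
    have := htP'.2
    grind
  have b3 : ¬ (shift (shift M v z u) u t w).Adj u w := by
    rw [shift_adj b1 htu.symm, a1]
    have := hwP.2
    have := hwt.ne
    grind
  -- Trade `uz`, `wt` for `vz`, `ut`, `uw`: both `u` and `v` gain one, all other degrees are kept.
  refine hno (hasFactor_iff.2 ⟨shift (shift M v z u) u t w ⊔ edge u w,
      sup_edge_le (shift_le (shift_le hM hzQ'.1) htP'.1) hwP.1, fun x => ?_⟩)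
  have e1 := dg_shift huz.symm hzv.symm hzQ'.2 x
  have e2 := dg_shift b1 htu.symm b2 x
  have e3 := dg_sup_edge hwu.symm b3 x
  have := hd x
  grind

/-- A factor using `uv` loses that edge and is then repaired. By truncation the threshold is `n - 1`
for `k = 1` and `n + 2k - 4` for `k ≥ 2`. -/
lemma hasFactor_of_sup_edge {G : SimpleGraph V} {k : ℕ} (hk : 1 ≤ k) {u v : V} (huv : u ≠ v)
    (hG : ¬ G.Adj u v) (hsum : Fintype.card V - 1 + (2 * k - 3) ≤ dg G u + dg G v)
    (h : HasFactor (G ⊔ edge u v) k) : HasFactor G k := by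
  obtain ⟨F, hF, hd⟩ := hasFactor_iff.1 h
  by_cases hFuv : F.Adj u v
  · have hle : F \ edge u v ≤ G := by
      rw [sdiff_le_iff, sup_comm]
      exact hF
    refine hasFactor_of_near hk huv hG hle ?_ ?_ (fun w hwu hwv => ?_) hsum
    · have := dg_sdiff_edge hFuv u
      simp only [if_true, huv, if_false, hd] at this
      exact this
    · have := dg_sdiff_edge hFuv v
      simp only [if_true, huv.symm, if_false, hd] at this
      exact this
    · have := dg_sdiff_edge hFuv w
      simp only [hwu, hwv, if_false, hd] at this
      exact this
  · refine hasFactor_iff.2 ⟨F, fun a b hab => ?_, hd⟩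
    have := hF hab
    rw [sup_adj, edge_adj] at this
    rcases this with h | ⟨⟨rfl, rfl⟩ | ⟨rfl, rfl⟩, -⟩
    · exact h
    · exact absurd hab hFuv
    · exact absurd hab.symm hFuv

lemma hasFactor_of_lClosure {G : SimpleGraph V} {k : ℕ} (hk : 1 ≤ k)
    (h : HasFactor (lClosure (Fintype.card V - 1 + (2 * k - 3)) G) k) : HasFactor G k := by
  have hs := (lClosure_spec (Fintype.card V - 1 + (2 * k - 3)) G).1
  revert h
  generalize lClosure (Fintype.card V - 1 + (2 * k - 3)) G = H at hs ⊢
  induction hs with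
  | refl => exact id
  | tail _ hs ih =>
    obtain ⟨u, v, huv, hadj, hdeg, rfl⟩ := hs
    rw [degree_eq_dg, degree_eq_dg] at hdeg
    exact fun h => ih (hasFactor_of_sup_edge hk huv hadj hdeg h)

end

/-! ### Clique counting and the shape of a closed graph. -/

section

variable {V : Type*} [Fintype V] [DecidableEq V]

/-- An `r`-clique either avoids `S` or consists of some `v ∈ S` and `r - 1` of its neighbours. -/
lemma card_cliqueFinset_le (H : SimpleGraph V) [DecidableRel H.Adj] {r h : ℕ}
    (S : Finset V) (hS : ∀ v ∈ S, dg H v ≤ h) :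
    (H.cliqueFinset r).card ≤
      (Fintype.card V - S.card).choose r + S.card * h.choose (r - 1) := by
  have hsub : H.cliqueFinset r ⊆ powersetCard r (univ \ S) ∪
      S.biUnion fun v => (powersetCard (r - 1) (nb H v)).image (insert v) := by
    intro T hT
    rw [mem_cliqueFinset_iff, isNClique_iff] at hT
    by_cases hd : ∃ v ∈ T, v ∈ S
    · obtain ⟨v, hvT, hvS⟩ := hd
      refine mem_union_right _ (mem_biUnion.2 ⟨v, hvS, mem_image.2 ⟨T.erase v, ?_, ?_⟩⟩)
      · rw [mem_powersetCard, card_erase_of_mem hvT, hT.2]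
        refine ⟨fun w hw => ?_, rfl⟩
        rw [mem_erase] at hw
        exact mem_nb.2 (hT.1 hvT hw.2 hw.1.symm)
      · exact insert_erase hvT
    · push Not at hd
      refine mem_union_left _ (mem_powersetCard.2 ⟨fun w hw => ?_, hT.2⟩)
      simpa using hd w hw
  refine (card_le_card hsub).trans ((card_union_le _ _).trans (Nat.add_le_add ?_ ?_))
  · rw [card_powersetCard, card_sdiff_of_subset (subset_univ S), card_univ]
  · refine card_biUnion_le_card_mul _ _ _ fun v hv => card_image_le.trans ?_
    rw [card_powersetCard]
    exact Nat.choose_le_choose _ (hS v hv)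

lemma cliqueFinset_card_mono {G H : SimpleGraph V} [DecidableRel G.Adj] [DecidableRel H.Adj]
    (h : G ≤ H) (r : ℕ) : (G.cliqueFinset r).card ≤ (H.cliqueFinset r).card :=
  card_le_card (cliqueFinset_mono _ h)

/-- The bound on the number of `r`-cliques in a graph of order `n` with `q + 1 - c` vertices of
degree at most `q`. -/
def bnd (n r c q : ℕ) : ℕ := (n - (q + 1 - c)).choose r + (q + 1 - c) * q.choose (r - 1)

lemma card_cliqueFinset_le_bnd (H : SimpleGraph V) [DecidableRel H.Adj] {n r c h : ℕ}
    (hn : Fintype.card V = n) (S : Finset V) (hS : ∀ v ∈ S, dg H v ≤ h)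
    (hcard : h + 1 - c ≤ S.card) : (H.cliqueFinset r).card ≤ bnd n r c h := by
  obtain ⟨T, hT, hTc⟩ := exists_subset_card_eq hcard
  have := card_cliqueFinset_le (r := r) H T fun v hv => hS v (hT hv)
  rwa [hTc, hn] at this

/-- Discrete convexity: if the increment at `h` is nonnegative then `f` does not decrease from `h`
on, otherwise it decreases up to `h`. -/
lemma le_max_of_monotone_diff {f D : ℕ → ℤ} {l m : ℕ}
    (hD : ∀ q, l ≤ q → q < m → f (q + 1) - f q = D q)
    (hmono : ∀ q q', l ≤ q → q ≤ q' → q' < m → D q ≤ D q') {h : ℕ} (hl : l ≤ h) (hm : h ≤ m) :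
    f h ≤ max (f l) (f m) := by
  rcases hm.eq_or_lt with rfl | hm'
  · exact le_max_right _ _
  rcases le_or_gt 0 (D h) with h0 | h0
  · refine le_trans ?_ (le_max_right _ _)
    have : ∀ q, h ≤ q → q ≤ m → f h ≤ f q := by
      intro q hq
      induction q, hq using Nat.le_induction with
      | base => exact fun _ => le_rfl
      | succ q hq ih =>
        intro hqm
        have := ih (by omega)
        have := hD q (by omega) (by omega)
        have := hmono h q hl hq (by omega)
        omega
    exact this m hm le_rfl
  · refine le_trans ?_ (le_max_left _ _)
    have : ∀ q, l ≤ q → q ≤ h → f q ≤ f l := by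
      intro q hq
      induction q, hq using Nat.le_induction with
      | base => exact fun _ => le_rfl
      | succ q hq ih =>
        intro hqm
        have := ih (by omega)
        have := hD q (by omega) (by omega)
        have := hmono q h (by omega) (by omega) (by omega)
        omega
    exact this h hl le_rfl

/-- By Pascal's rule the increment of the bound is `D`, each of whose three terms is nondecreasing
in `q`. -/
lemma bnd_le_max {n r c l m h : ℕ} (hr : 2 ≤ r) (hc : c ≤ l) (hmn : m + 1 ≤ n + c) (hl : l ≤ h)
    (hm : h ≤ m) : bnd n r c h ≤ max (bnd n r c l) (bnd n r c m) := by
  obtain ⟨p, rfl⟩ : ∃ p, r = p + 2 := ⟨r - 2, by omega⟩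
  have key := le_max_of_monotone_diff (f := fun q => (bnd n (p + 2) c q : ℤ))
    (D := fun q => -((n - (q + 2 - c)).choose (p + 1) : ℤ) + q.choose (p + 1)
      + (q + 2 - c : ℕ) * q.choose p) (l := l) (m := m) ?_ ?_ hl hm
  · exact_mod_cast key
  · intro q hq hqm
    obtain ⟨T, rfl⟩ : ∃ T, q = T + c := ⟨q - c, by omega⟩
    obtain ⟨M, hM⟩ : ∃ M, n = M + T + 2 := ⟨n - (T + 2), by omega⟩
    subst hM
    have e1 : T + c + 1 + 1 - c = T + 2 := by omega
    have e2 : T + c + 1 - c = T + 1 := by omega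
    have e4 : M + T + 2 - (T + 2) = M := by omega
    have e5 : M + T + 2 - (T + 1) = M + 1 := by omega
    have e6 : p + 2 - 1 = p + 1 := by omega
    simp only [bnd, e1, e2, e4, e5, e6]
    rw [Nat.choose_succ_succ M (p + 1), Nat.choose_succ_succ (T + c) p]
    push_cast
    ring
  · intro q q' hq hqq hq'
    have h1 : (n - (q' + 2 - c)).choose (p + 1) ≤ (n - (q + 2 - c)).choose (p + 1) :=
      Nat.choose_le_choose _ (by omega)
    have h2 : q.choose (p + 1) ≤ q'.choose (p + 1) := Nat.choose_le_choose _ hqq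
    have h3 : (q + 2 - c) * q.choose p ≤ (q' + 2 - c) * q'.choose p :=
      Nat.mul_le_mul (by omega) (Nat.choose_le_choose _ hqq)
    zify at h1 h2 h3
    linarith

/-- The vertex set is partitioned into `A`, `B`, `L`, where `A ∪ B` is a clique, `L` consists of
`s` vertices of degree `d`, all of `L` is joined to `A` and nothing in `L` to `B`. -/
structure IsSplit (H : SimpleGraph V) (d s : ℕ) (A B L : Finset V) : Prop where
  disj_AB : Disjoint A B
  disj_AL : Disjoint A L
  disj_BL : Disjoint B L
  cover : ∀ x, x ∈ A ∨ x ∈ B ∨ x ∈ L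
  clique : ∀ x ∉ L, ∀ y ∉ L, x ≠ y → H.Adj x y
  join : ∀ x ∈ A, ∀ y ∈ L, H.Adj x y
  nonadj : ∀ x ∈ B, ∀ y ∈ L, ¬ H.Adj x y
  degree : ∀ x ∈ L, dg H x = d
  card : L.card = s
  card_A : A.card ≤ d

lemma card_nonneighbors (H : SimpleGraph V) (v : V) :
    (univ \ insert v (nb H v)).card + dg H v + 1 = Fintype.card V := by
  have h1 := card_sdiff_add_card_eq_card (subset_univ (insert v (nb H v)))
  rw [card_insert_of_notMem (by simp), card_univ] at h1
  unfold dg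
  omega

lemma exists_isSplit {H : SimpleGraph V} [DecidableRel H.Adj] {n r c δ : ℕ}
    (hn : Fintype.card V = n) (hr : 2 ≤ r) (hc : c ≤ δ) (hnδ : 2 * δ + 2 ≤ n)
    (hδ : ∀ v, δ ≤ dg H v)
    (hcl : ∀ u v, u ≠ v → ¬ H.Adj u v → dg H u + dg H v < n - 1 + c)
    (hN : max (bnd n r c (δ + 1)) (bnd n r c ((n - 2 + c) / 2)) < (H.cliqueFinset r).card)
    (hne : H ≠ ⊤) : ∃ A B L, IsSplit H δ (δ + 1 - c) A B L := by
  set L := univ.filter fun v => dg H v ≤ δ with hL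
  have memL : ∀ v, v ∈ L ↔ dg H v ≤ δ := by simp [hL]
  have mem_non : ∀ v w, w ∈ univ \ insert v (nb H v) ↔ w ≠ v ∧ ¬ H.Adj v w := by simp
  have clique : ∀ x ∉ L, ∀ y ∉ L, x ≠ y → H.Adj x y := by
    by_contra hcon
    push Not at hcon
    obtain ⟨x, hx, y, hy, hxy, hadj⟩ := hcon
    set E := (univ : Finset (V × V)).filter
      fun p => p.1 ∉ L ∧ p.2 ∉ L ∧ p.1 ≠ p.2 ∧ ¬ H.Adj p.1 p.2 with hE
    have memE : ∀ a b, (a, b) ∈ E ↔ a ∉ L ∧ b ∉ L ∧ a ≠ b ∧ ¬ H.Adj a b := by simp [hE]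
    obtain ⟨⟨u, v⟩, huv, hmax⟩ := exists_max_image E (fun p => dg H p.1 + dg H p.2)
      ⟨(x, y), (memE x y).2 ⟨hx, hy, hxy, hadj⟩⟩
    wlog hle : dg H u ≤ dg H v generalizing u v
    · refine this v u ?_ ?_ (by omega)
      · rw [memE] at huv ⊢
        exact ⟨huv.2.1, huv.1, huv.2.2.1.symm, fun h => huv.2.2.2 h.symm⟩
      · intro p hp
        have := hmax p hp
        simp only at this ⊢
        omega
    rw [memE] at huv
    obtain ⟨hu, hv, hne', hnadj⟩ := huv
    have hsum := hcl u v hne' hnadj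
    -- Nonneighbours of `v` in `L` have degree at most `δ`, the others at most `dg H u` by
    -- maximality. Closedness provides at least `dg H u + 1 - c` of them, so convexity of the bound
    -- contradicts the clique count.
    have hlow : ∀ w ∈ univ \ insert v (nb H v), dg H w ≤ dg H u := by
      intro w hw
      rw [mem_non] at hw
      rw [memL] at hu
      by_cases hwL : w ∈ L
      · rw [memL] at hwL
        omega
      · have := hmax (w, v) ((memE w v).2 ⟨hwL, hv, hw.1, fun h => hw.2 h.symm⟩)
        simp only at this
        omega
    have hcard := card_nonneighbors H v
    rw [memL] at hu
    have h1 := card_cliqueFinset_le_bnd (c := c) (r := r) H hn _ hlow (by omega)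
    have h2 : bnd n r c (dg H u) ≤ _ :=
      bnd_le_max (l := δ + 1) (m := (n - 2 + c) / 2) (h := dg H u) hr (by omega) (by omega)
        (by omega) (by omega)
    omega
  have cardL : L.card ≤ δ + 1 - c := by
    by_contra hlt
    have h1 := card_cliqueFinset_le_bnd (c := c) (r := r) (h := δ + 1) H hn L
      (fun v hv => by rw [memL] at hv; omega) (by omega)
    have := le_max_left (bnd n r c (δ + 1)) (bnd n r c ((n - 2 + c) / 2))
    omega
  obtain ⟨l, hl⟩ : ∃ l, l ∈ L := by
    by_contra hcon
    push Not at hcon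
    refine hne (top_unique fun x y hxy => clique x (hcon x) y (hcon y) hxy)
  have degL : ∀ x ∈ L, dg H x = δ := fun x hx => le_antisymm ((memL x).1 hx) (hδ x)
  -- Closedness gives `x` at least `δ + 1 - c` nonneighbours. All lie in `L`, which has no more
  -- vertices than that.
  have hB : ∀ x ∉ L, ∀ y ∈ L, ¬ H.Adj x y →
      univ \ insert x (nb H x) = L ∧ L.card = δ + 1 - c := by
    intro x hx y hy hxy
    have hsum := hcl x y (fun h => hx (h ▸ hy)) hxy
    have hcard := card_nonneighbors H x
    have := degL y hy
    have hsub : univ \ insert x (nb H x) ⊆ L := by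
      intro w hw
      rw [mem_non] at hw
      by_contra hwL
      exact hw.2 (clique x hx w hwL hw.1.symm)
    have hle := card_le_card hsub
    exact ⟨eq_of_subset_of_card_le hsub (by omega), by omega⟩
  set A := univ.filter fun x => x ∉ L ∧ ∀ y ∈ L, H.Adj x y with hA
  set B := univ.filter fun x => x ∉ L ∧ ∃ y ∈ L, ¬ H.Adj x y with hBdef
  have memA : ∀ x, x ∈ A ↔ x ∉ L ∧ ∀ y ∈ L, H.Adj x y := by simp [hA]
  have memB : ∀ x, x ∈ B ↔ x ∉ L ∧ ∃ y ∈ L, ¬ H.Adj x y := by simp [hBdef]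
  have cardA : A.card ≤ δ := by
    rw [← degL l hl]
    refine card_le_card fun x hx => mem_nb.2 ?_
    exact (((memA x).1 hx).2 l hl).symm
  have cover : ∀ x, x ∈ A ∨ x ∈ B ∨ x ∈ L := by
    intro x
    rw [memA, memB]
    by_cases hx : x ∈ L
    · tauto
    · by_cases h : ∀ y ∈ L, H.Adj x y
      · tauto
      · push Not at h
        exact Or.inr (Or.inl ⟨hx, h⟩)
  obtain ⟨b, hb⟩ : ∃ b, b ∈ B := by
    by_contra hcon
    push Not at hcon
    have : (univ : Finset V) ⊆ A ∪ L := fun x _ => by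
      have := cover x
      have := hcon x
      rw [mem_union]
      tauto
    have := (card_le_card this).trans (card_union_le _ _)
    rw [card_univ] at this
    omega
  refine ⟨A, B, L, ?_, ?_, ?_, cover, clique, fun x hx => ((memA x).1 hx).2, ?_, degL, ?_, cardA⟩
  · rw [Finset.disjoint_left]
    intro x hx hx'
    rw [memA] at hx
    obtain ⟨-, y, hy, hxy⟩ := (memB x).1 hx'
    exact hxy (hx.2 y hy)
  · rw [Finset.disjoint_left]
    exact fun x hx => ((memA x).1 hx).1
  · rw [Finset.disjoint_left]
    exact fun x hx => ((memB x).1 hx).1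
  · intro x hx y hy
    obtain ⟨hxL, z, hz, hxz⟩ := (memB x).1 hx
    have := (hB x hxL z hz hxz).1
    rw [← this, mem_non] at hy
    exact hy.2
  · obtain ⟨hxL, z, hz, hxz⟩ := (memB b).1 hb
    exact (hB b hxL z hz hxz).2

end

/-! ### Extending a partial factor through a clique, and optimal subgraphs around `L`. -/

section

variable {V : Type*} [Fintype V]

lemma even_sum_dg (M : SimpleGraph V) : Even (∑ v, dg M v) := by
  classical
  have := M.sum_degrees_eq_twice_card_edges
  simp only [degree_eq_dg] at this
  rw [this]
  exact even_two_mul _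

/-- `M` has the largest degree sum on `L` among the subgraphs of `J` of maximum degree at most
`k`. -/
structure IsOpt (J : SimpleGraph V) (L : Finset V) (k : ℕ) (M : SimpleGraph V) : Prop where
  le : M ≤ J
  bound : ∀ v, dg M v ≤ k
  max : ∀ N ≤ J, (∀ v, dg N v ≤ k) → ∑ x ∈ L, dg N x ≤ ∑ x ∈ L, dg M x

lemma exists_isOpt (J : SimpleGraph V) (L : Finset V) (k : ℕ) : ∃ M, IsOpt J L k M := by
  obtain ⟨M, ⟨hM, hd⟩, hmax⟩ := Set.exists_max_image
    {M : SimpleGraph V | M ≤ J ∧ ∀ v, dg M v ≤ k} (fun M => ∑ v ∈ L, dg M v) (Set.toFinite _)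
    ⟨⊥, bot_le, fun v => by simp [dg, nb]⟩
  exact ⟨M, hM, hd, fun N hN hNd => hmax N ⟨hN, hNd⟩⟩

variable [DecidableEq V]

lemma sum_dg_sup_edge {M : SimpleGraph V} {a b : V} (hab : a ≠ b) (h : ¬ M.Adj a b)
    (L : Finset V) : ∑ x ∈ L, dg (M ⊔ edge a b) x =
      ∑ x ∈ L, dg M x + (if a ∈ L then 1 else 0) + (if b ∈ L then 1 else 0) := by
  simp [dg_sup_edge hab h, sum_add_distrib]

lemma sum_dg_shift {M : SimpleGraph V} {u x y : V} (hxy : M.Adj x y) (hux : u ≠ x)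
    (h : ¬ M.Adj u x) (L : Finset V) :
    ∑ w ∈ L, dg (shift M u x y) w + (if y ∈ L then 1 else 0) =
      ∑ w ∈ L, dg M w + (if u ∈ L then 1 else 0) := by
  have := sum_congr (rfl : L = L) fun w _ => dg_shift hxy hux h w
  simpa [sum_add_distrib] using this

/-- A subgraph of maximum degree at most `k` that is saturated outside a clique `X` extends to a
`k`-factor when `X` contains enough vertices without neighbours outside `X`. -/
lemma hasFactor_of_partial {H F₀ : SimpleGraph V} {k : ℕ} {X B : Finset V}
    (hX : ∀ x ∈ X, ∀ y ∈ X, x ≠ y → H.Adj x y) (hBX : B ⊆ X)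
    (hB : ∀ x ∈ B, ∀ y ∉ X, ¬ H.Adj x y) (hcard : 2 * k ≤ B.card + 1) (hle : F₀ ≤ H)
    (hdeg : ∀ v, dg F₀ v ≤ k) (hsat : ∀ v ∉ X, dg F₀ v = k)
    (heven : Even (Fintype.card V * k)) : HasFactor H k := by
  obtain ⟨F, ⟨hF, hFd, hFX⟩, hmax⟩ := Set.exists_max_image
    {F : SimpleGraph V | F ≤ H ∧ (∀ v, dg F v ≤ k) ∧ ∀ v ∉ X, dg F v = k}
    (fun F => ∑ v, dg F v) (Set.toFinite _) ⟨F₀, hle, hdeg, hsat⟩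
  by_contra hno
  obtain ⟨u, hu⟩ : ∃ u, dg F u < k := by
    by_contra hcon
    push Not at hcon
    exact hno (hasFactor_iff.2 ⟨F, hF, fun v => le_antisymm (hFd v) (hcon v)⟩)
  have memX : ∀ v, dg F v < k → v ∈ X := fun v hv => by
    by_contra h
    have := hFX v h
    omega
  have adj_of_lt : ∀ a b, a ≠ b → dg F a < k → dg F b < k → F.Adj a b := by
    intro a b hab ha hb
    by_contra h
    have h1 := hmax (F ⊔ edge a b) ⟨sup_edge_le hF (hX a (memX a ha) b (memX b hb) hab), ?_, ?_⟩
    · simp only [sum_dg_sup_edge hab h, mem_univ, if_true] at h1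
      omega
    · intro v
      have := dg_sup_edge hab h v
      have := hFd v
      grind
    · intro v hv
      have := dg_sup_edge hab h v
      have := hFX v hv
      have := memX a ha
      have := memX b hb
      grind
  -- The total deficiency is even, so a second unit of it exists, at another vertex or again at `u`.
  obtain ⟨v, hv, hv'⟩ : ∃ v, dg F v < k ∧ (v = u → dg F u + 2 ≤ k) := by
    by_contra hcon
    push Not at hcon
    have h1 := hcon u hu
    have h2 : ∀ v, dg F v + (if v = u then 1 else 0) = k := by
      intro v
      have := hcon v
      have := hFd v
      grind
    have h3 := sum_congr (rfl : (univ : Finset V) = univ) fun v _ => h2 v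
    simp only [sum_add_distrib, sum_ite_eq', mem_univ, if_true, sum_const, card_univ,
      smul_eq_mul] at h3
    have := even_sum_dg F
    rw [← h3] at heven
    grind
  -- Distinct deficient `u`, `v` are adjacent, so their neighbourhoods contain both of them and have
  -- at most `2k - 2` vertices in all, fewer than `B`. For `v = u` the closed neighbourhood has at
  -- most `k - 1`.
  obtain ⟨y, hyB, hyu, hyv, hyu', hyv'⟩ :
      ∃ y ∈ B, y ≠ u ∧ y ≠ v ∧ ¬ F.Adj u y ∧ ¬ F.Adj v y := by
    by_contra hcon
    push Not at hcon
    by_cases hvu : v = u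
    · subst hvu
      have hsub : B ⊆ insert v (nb F v) := by
        intro y hy
        have := hcon y hy
        simp only [mem_insert, mem_nb]
        tauto
      have h1 := (card_le_card hsub).trans (card_insert_le _ _)
      have h2 := hv' rfl
      have h3 : (nb F v).card = dg F v := rfl
      omega
    · have huv := adj_of_lt u v (Ne.symm hvu) hu hv
      have hsub : B ⊆ nb F u ∪ nb F v := by
        intro y hy
        have := hcon y hy
        rw [mem_union, mem_nb, mem_nb]
        by_cases h1 : y = u
        · exact Or.inr (h1 ▸ huv.symm)
        by_cases h2 : y = v
        · exact Or.inl (h2 ▸ huv)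
        tauto
      have h1 := (card_le_card hsub).trans (card_union_le _ _)
      have h2 : (nb F u).card = dg F u := rfl
      have h3 : (nb F v).card = dg F v := rfl
      omega
  have hyk : dg F y = k := by
    by_contra h
    have := hFd y
    exact hyu' (adj_of_lt u y hyu.symm hu (by omega))
  obtain ⟨x, hxy, hxu⟩ : ∃ x, F.Adj x y ∧ ¬ F.Adj u x := by
    by_contra hcon
    push Not at hcon
    have : nb F y ⊆ nb F u := fun x hx => mem_nb.2 (hcon x (mem_nb.1 hx).symm)
    have h1 : dg F y ≤ dg F u := card_le_card this
    omega
  have hux : u ≠ x := fun h => hyu' (h ▸ hxy)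
  have hxX : x ∈ X := by
    by_contra h
    exact hB y hyB x h (hF hxy).symm
  have huX := memX u hu
  have hvX := memX v hv
  have hyX := hBX hyB
  have hxy' := hxy.ne
  have hyv'' : ¬ F.Adj y v := fun h => hyv' h.symm
  have h1 : ¬ (shift F u x y).Adj y v := by
    rw [shift_adj hxy hux]
    grind
  -- Trading `xy` for `ux` and `yv` raises the degree sum by two.
  have h2 := hmax (shift F u x y ⊔ edge y v) ⟨sup_edge_le (shift_le hF (hX u huX x hxX hux))
    (hX y hyX v hvX hyv), ?_, ?_⟩
  · have e := sum_dg_shift hxy hux hxu univ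
    simp only [sum_dg_sup_edge hyv h1, mem_univ, if_true] at h2 e
    omega
  · intro w
    have := dg_sup_edge hyv h1 w
    have := dg_shift hxy hux hxu w
    have := hFd w
    grind
  · intro w hw
    have := dg_sup_edge hyv h1 w
    have := dg_shift hxy hux hxu w
    have := hFX w hw
    grind

/-- All edges of `J` meet `L`, every vertex of `L` is joined to all of `A`, and the neighbours of
`L` lie in `A ∪ L`. -/
structure IsFringe (J : SimpleGraph V) (A L : Finset V) : Prop where
  disj : ∀ x ∈ A, x ∉ L
  adj : ∀ x y, J.Adj x y → (x ∈ L ∧ y ∈ L) ∨ (x ∈ L ∧ y ∈ A) ∨ (x ∈ A ∧ y ∈ L)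
  join : ∀ x ∈ L, ∀ y ∈ A, J.Adj x y

variable {J M : SimpleGraph V} {A L : Finset V} {k : ℕ} {u : V}

lemma IsOpt.saturated_A (hJ : IsFringe J A L) (hM : IsOpt J L k M) (hu : u ∈ L)
    (huk : dg M u < k) {p : V} (hp : p ∈ A) (hup : ¬ M.Adj u p) : dg M p = k := by
  by_contra h
  have hpk := hM.bound p
  have hne : u ≠ p := fun e => hJ.disj p hp (e ▸ hu)
  have h1 := hM.max (M ⊔ edge u p) (sup_edge_le hM.le (hJ.join u hu p hp)) fun v => by
    have := dg_sup_edge hne hup v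
    have := hM.bound v
    grind
  rw [sum_dg_sup_edge hne hup, if_pos hu] at h1
  omega

lemma IsOpt.saturated_L (hM : IsOpt J L k M) (hu : u ∈ L)
    (huk : dg M u < k) {w : V} (huw : J.Adj u w) (hMw : ¬ M.Adj u w) : dg M w = k := by
  by_contra h
  have hpk := hM.bound w
  have hne := huw.ne
  have h1 := hM.max (M ⊔ edge u w) (sup_edge_le hM.le huw) fun v => by
    have := dg_sup_edge huw.ne hMw v
    have := hM.bound v
    grind
  rw [sum_dg_sup_edge huw.ne hMw, if_pos hu] at h1
  omega

/-- Replacing `wp` by `uw` would lose degree only at `p`, outside `L`, and gain one at `u`. -/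
lemma IsOpt.not_adj_A (hJ : IsFringe J A L) (hM : IsOpt J L k M) (hu : u ∈ L)
    (huk : dg M u < k) {w : V} (huw : J.Adj u w) (hMw : ¬ M.Adj u w) {p : V}
    (hp : p ∈ A) : ¬ M.Adj w p := by
  intro h
  have h1 := hM.max (shift M u w p) (shift_le hM.le huw) fun v => by
    have := dg_shift h huw.ne hMw v
    have := hM.bound v
    grind
  have h2 := sum_dg_shift h huw.ne hMw L
  rw [if_pos hu, if_neg (hJ.disj p hp)] at h2
  omega

lemma IsFringe.card_nb (hJ : IsFringe J A L) (hu : u ∈ L) :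
    (L ∩ nb J u).card + A.card = dg J u := by
  have h : nb J u = (L ∩ nb J u) ∪ A := by
    ext x
    have := hJ.adj u x
    have := hJ.join u hu x
    have := hJ.disj u
    simp only [mem_nb, mem_union, mem_inter]
    tauto
  rw [dg, h, card_union_of_disjoint, ← h]
  rw [Finset.disjoint_left]
  exact fun x hx hxA => hJ.disj x hxA (mem_inter.1 hx).1

lemma IsFringe.card_nonadj (hu : u ∈ L) :
    ((L \ nb J u).erase u).card + 1 + (L ∩ nb J u).card = L.card := by
  have h1 := card_erase_add_one (show u ∈ L \ nb J u by simp [hu])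
  have h2 := card_sdiff_add_card_inter L (nb J u)
  omega

lemma IsOpt.card_split (hJ : IsFringe J A L) (hM : IsOpt J L k M) :
    (A ∩ nb M u).card + (L ∩ nb M u).card = dg M u := by
  rw [← card_union_of_disjoint]
  · rw [dg]
    congr 1
    ext x
    have h1 : M.Adj u x → J.Adj u x := fun h => hM.le h
    have := hJ.adj u x
    simp only [mem_nb, mem_union, mem_inter]
    tauto
  · rw [Finset.disjoint_left]
    exact fun x hx hxL => hJ.disj x (mem_inter.1 hx).1 (mem_inter.1 hxL).1

/-- Counting the edges between `A` and `L` in an optimal subgraph, seen from an unsaturated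
vertex `u`. -/
lemma IsOpt.count (hJ : IsFringe J A L) (hM : IsOpt J L k M) (hu : u ∈ L)
    (huk : dg M u < k) :
    k * (A \ nb M u).card + ∑ p ∈ A ∩ nb M u, dg M p ≤
      (A ∩ nb M u).card + (k - 1) * (L ∩ nb M u).card +
        ∑ x ∈ (L \ nb J u).erase u, (nb M x ∩ A).card := by
  have e1 : ∑ p ∈ A, dg M p = ∑ x ∈ L, (nb M x ∩ A).card := by
    rw [← sum_card_nb_inter]
    refine sum_congr rfl fun p hp => ?_
    rw [dg, inter_eq_left.2]
    intro x hx
    have := hJ.adj p x (hM.le (mem_nb.1 hx))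
    have := hJ.disj p hp
    tauto
  have e2 : ∑ p ∈ A \ nb M u, dg M p = k * (A \ nb M u).card := by
    rw [mul_comm]
    refine sum_const_nat fun p hp => ?_
    rw [mem_sdiff, mem_nb] at hp
    exact hM.saturated_A hJ hu huk hp.1 hp.2
  have e3 : ∑ p ∈ A ∩ nb M u, dg M p + ∑ p ∈ A \ nb M u, dg M p = ∑ p ∈ A, dg M p :=
    sum_inter_add_sum_sdiff ..
  have e4 : ∑ x ∈ L ∩ nb J u, (nb M x ∩ A).card + ∑ x ∈ L \ nb J u, (nb M x ∩ A).card =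
      ∑ x ∈ L, (nb M x ∩ A).card := sum_inter_add_sum_sdiff ..
  have e5 : ∑ x ∈ L \ nb J u, (nb M x ∩ A).card =
      (nb M u ∩ A).card + ∑ x ∈ (L \ nb J u).erase u, (nb M x ∩ A).card :=
    (add_sum_erase _ _ (by simp [hu])).symm
  -- A `J`-neighbour of `u` in `L` contributes only if it is an `M`-neighbour, and then `u` takes
  -- one of its at most `k` edges.
  have e6 : ∑ x ∈ L ∩ nb J u, (nb M x ∩ A).card ≤ (k - 1) * (L ∩ nb M u).card := by
    have h1 : L ∩ nb M u = (L ∩ nb J u).filter (· ∈ nb M u) := by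
      ext x
      have h1 : M.Adj u x → J.Adj u x := fun h => hM.le h
      simp only [mem_nb, mem_filter, mem_inter]
      tauto
    rw [h1, card_filter, mul_sum]
    refine sum_le_sum fun x hx => ?_
    rw [mem_inter, mem_nb] at hx
    split_ifs with hxu
    · rw [mem_nb] at hxu
      have hsub : nb M x ∩ A ⊆ (nb M x).erase u := by
        intro y hy
        rw [mem_inter] at hy
        exact mem_erase.2 ⟨fun e => hJ.disj y hy.2 (e ▸ hu), hy.1⟩
      have h2 := card_le_card hsub
      rw [card_erase_of_mem (mem_nb.2 hxu.symm)] at h2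
      have h3 : (nb M x).card ≤ k := hM.bound x
      omega
    · rw [mem_nb] at hxu
      rw [mul_zero, Nat.le_zero, card_eq_zero, ← disjoint_iff_inter_eq_empty, Finset.disjoint_left]
      exact fun y hy hyA => hM.not_adj_A hJ hu huk hx.2 hxu hyA (mem_nb.1 hy)
  rw [inter_comm (nb M u)] at e5
  omega

lemma IsOpt.sum_le (hM : IsOpt J L k M) (R : Finset V) :
    ∑ x ∈ R, (nb M x ∩ A).card ≤ k * R.card := by
  rw [mul_comm]
  exact sum_le_card_nsmul _ _ _ fun x _ => (card_le_card inter_subset_left).trans (hM.bound x)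

lemma IsOpt.tight (hM : IsOpt J L k M) {R : Finset V}
    (h : k * R.card ≤ ∑ x ∈ R, (nb M x ∩ A).card) {x : V} (hx : x ∈ R) :
    (nb M x ∩ A).card = k := by
  have hk : ∀ x ∈ R, (nb M x ∩ A).card ≤ k :=
    fun x _ => (card_le_card inter_subset_left).trans (hM.bound x)
  have h1 : ∑ x ∈ R, (nb M x ∩ A).card = ∑ x ∈ R, k := by
    rw [sum_const, smul_eq_mul, mul_comm]
    exact le_antisymm (hM.sum_le R) h
  exact (sum_eq_sum_iff_of_le hk).1 h1 x hx

lemma IsOpt.adj_A_of_tight (hM : IsOpt J L k M) {x y : V} (h : (nb M x ∩ A).card = k)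
    (hxy : M.Adj x y) : y ∈ A := by
  have h1 : nb M x ∩ A = nb M x :=
    eq_of_subset_of_card_le inter_subset_left (h ▸ hM.bound x)
  exact (mem_inter.1 (h1 ▸ mem_nb.2 hxy)).2

/-- With `R` the other vertices of `L` not `J`-adjacent to `u`, the degree condition gives `|A| =
|R| + 2k - 3`. The edge count then leaves only `k = 2`, with `u` and its sole `M`-neighbour `p` both
of degree one, and an exchange through `p` finishes. -/
lemma IsOpt.saturated_of_two_le (hJ : IsFringe J A L) (hM : IsOpt J L k M) (hk : 2 ≤ k) {d : ℕ}
    (hd : ∀ x ∈ L, dg J x = d) (hcard : d + 4 = L.card + 2 * k) (hL : 2 ≤ L.card) :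
    ∀ x ∈ L, dg M x = k := by
  intro u hu
  by_contra hne
  have huk : dg M u < k := lt_of_le_of_ne (hM.bound u) hne
  have c1 := hM.count hJ hu huk
  have c2 := hM.card_split (u := u) hJ
  have c3 := hJ.card_nb hu
  have c4 := IsFringe.card_nonadj (J := J) hu
  have c5 := hM.sum_le (A := A) ((L \ nb J u).erase u)
  have c6 := card_sdiff_add_card_inter A (nb M u)
  have c7 : (A ∩ nb M u).card ≤ ∑ p ∈ A ∩ nb M u, dg M p := by
    rw [card_eq_sum_ones]
    refine sum_le_sum fun p hp => ?_
    rw [mem_inter, mem_nb] at hp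
    exact card_pos.2 ⟨u, mem_nb.2 hp.2.symm⟩
  rw [hd u hu] at c3
  set R := (L \ nb J u).erase u with hR
  set α := (A ∩ nb M u).card with hα
  set β := (L ∩ nb M u).card with hβ
  set D := (A \ nb M u).card with hD
  have hDR : D + α = R.card + 2 * k - 3 := by omega
  obtain ⟨j, rfl⟩ : ∃ j, k = j + 2 := ⟨k - 2, by omega⟩
  have e1 : j + 2 - 1 = j + 1 := by omega
  rw [e1] at c1
  -- `γ` is the slack in `α + β ≤ k - 1`; the count forces `j`, `β` and `γ` to vanish.
  obtain ⟨γ, hγ⟩ : ∃ γ, D = R.card + j + β + γ := ⟨D - (R.card + j + β), by omega⟩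
  have hexp : (j + 2) * D = (j + 2) * R.card + (j + 2) * j + (j + 1) * β + β + (j + 2) * γ := by
    rw [hγ]
    ring
  have hj : (j + 2) * j = 0 := by omega
  have hj0 : j = 0 := by simpa using hj
  subst hj0
  have hγ0 : γ = 0 := by omega
  have hβ0 : β = 0 := by omega
  have hα1 : α = 1 := by omega
  obtain ⟨p, hp⟩ := card_eq_one.1 (show (A ∩ nb M u).card = 1 from hα1)
  rw [hp, sum_singleton] at c1 c7
  have hpmem : p ∈ A ∩ nb M u := hp ▸ mem_singleton_self p
  rw [mem_inter, mem_nb] at hpmem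
  obtain ⟨hpA, hup⟩ := hpmem
  have hp1 : dg M p = 1 := by omega
  have tight : ∀ x ∈ R, (nb M x ∩ A).card = 0 + 2 := fun x hx => hM.tight (by omega) hx
  have hpL := hJ.disj p hpA
  have onlyp : ∀ q ∈ A, M.Adj u q → q = p := fun q hq h => by
    have : q ∈ A ∩ nb M u := mem_inter.2 ⟨hq, mem_nb.2 h⟩
    rw [hp] at this
    exact mem_singleton.1 this
  have onlyu : ∀ x, M.Adj p x → x = u := fun x hx => by
    obtain ⟨z, hz⟩ := card_eq_one.1 hp1
    have h1 : u ∈ nb M p := mem_nb.2 hup.symm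
    have h2 : x ∈ nb M p := mem_nb.2 hx
    rw [hz, mem_singleton] at h1 h2
    rw [h1, h2]
  have notL : ∀ w ∈ L, ¬ M.Adj u w := fun w hw h => by
    have : w ∈ L ∩ nb M u := mem_inter.2 ⟨hw, mem_nb.2 h⟩
    rw [Finset.card_eq_zero.1 (show (L ∩ nb M u).card = 0 from hβ0)] at this
    simp at this
  obtain ⟨x, hx, hxu⟩ := exists_mem_ne (show 1 < L.card by omega) u
  by_cases hw : ∃ w ∈ L, J.Adj u w
  · obtain ⟨w, hwL, huw⟩ := hw
    have hMw := notL w hwL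
    have hwk := hM.saturated_L hu huk huw hMw
    obtain ⟨y, hy⟩ : (nb M w).Nonempty := card_pos.1 (by change 0 < dg M w; omega)
    have hwy := mem_nb.1 hy
    have hyA : y ∉ A := fun h => hM.not_adj_A hJ hu huk huw hMw h hwy
    have hyL : y ∈ L := by
      have := hJ.adj w y (hM.le hwy)
      tauto
    have hyu : y ≠ u := fun h => hMw (h ▸ hwy.symm)
    have hyp : ¬ M.Adj y p := fun h => hyu (onlyu y h.symm)
    have huy : J.Adj u y := by
      by_contra h
      have : y ∈ R := by simp [hR, hyu, hyL, h]
      have := hM.adj_A_of_tight (tight y this) hwy.symm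
      exact hJ.disj w this hwL
    have hwp : w ≠ p := fun h => hpL (h ▸ hwL)
    have hyp' : y ≠ p := fun h => hpL (h ▸ hyL)
    have h1 : ¬ (shift M u w y).Adj y p := by
      rw [shift_adj hwy huw.ne]
      grind
    have hpu : p ≠ u := hup.ne'
    -- Trade `wy` for `uw` and `yp`; `p` has room for one more edge.
    have h2 := hM.max (shift M u w y ⊔ edge y p)
      (sup_edge_le (shift_le hM.le huw) (hJ.join y hyL p hpA)) fun v => by
        have := dg_shift hwy huw.ne hMw v
        have := dg_sup_edge hyp' h1 v
        have := hM.bound v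
        grind
    have h3 := sum_dg_shift hwy huw.ne hMw L
    rw [sum_dg_sup_edge hyp' h1, if_pos hyL, if_neg hpL] at h2
    rw [if_pos hyL, if_pos hu] at h3
    omega
  · push Not at hw
    have hxR : x ∈ R := by simp [hR, hx, hxu, hw x hx]
    have hxp : ¬ M.Adj x p := fun h => hxu (onlyu x h.symm)
    obtain ⟨q, hq⟩ : (nb M x ∩ A).Nonempty := card_pos.1 (by rw [tight x hxR]; omega)
    rw [mem_inter, mem_nb] at hq
    obtain ⟨hxq, hqA⟩ := hq
    have hqp : q ≠ p := fun h => hxp (h ▸ hxq)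
    have huq : ¬ M.Adj u q := fun h => hqp (onlyp q hqA h)
    have hqu : u ≠ q := fun h => hJ.disj q hqA (h ▸ hu)
    have hxp' : x ≠ p := fun h => hpL (h ▸ hx)
    have hpu : p ≠ u := hup.ne'
    have h1 : ¬ (shift M u q x).Adj x p := by
      rw [shift_adj hxq.symm hqu]
      grind
    -- Trade `qx` for `uq` and `xp`.
    have h2 := hM.max (shift M u q x ⊔ edge x p)
      (sup_edge_le (shift_le hM.le (hJ.join u hu q hqA)) (hJ.join x hx p hpA)) fun v => by
        have := dg_shift hxq.symm hqu huq v
        have := dg_sup_edge hxp' h1 v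
        have := hM.bound v
        grind
    have h3 := sum_dg_shift hxq.symm hqu huq L
    rw [sum_dg_sup_edge hxp' h1, if_pos hx, if_neg hpL] at h2
    rw [if_pos hx, if_pos hu] at h3
    omega

end

/-! ### Saturating `L` for `k = 1`, and factors of split graphs. -/

section

variable {V : Type*} [Fintype V] [DecidableEq V]

section

variable {J M : SimpleGraph V} {A L : Finset V} {u : V}

/-- All of `A` is saturated since `u` is isolated, and `A` has as many vertices as the set
containing `x`, so the edge count is tight. -/
lemma IsOpt.tight_of_isolated (hJ : IsFringe J A L) (hM : IsOpt J L 1 M)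
    (hcard : dg J u + 1 = L.card) (hu : u ∈ L) (hu0 : dg M u = 0) {x : V}
    (hx : x ∈ (L \ nb J u).erase u) : (nb M x ∩ A).card = 1 := by
  have c1 := hM.count hJ hu (by omega)
  have c2 := hM.card_split (u := u) hJ
  have c3 := hJ.card_nb hu
  have c4 := IsFringe.card_nonadj (J := J) hu
  have c6 := card_sdiff_add_card_inter A (nb M u)
  have c7 : (L ∩ nb M u).card = 0 := by omega
  rw [c7] at c1
  exact hM.tight (by omega) hx

/-- If `A` is empty, `J` is complete on `L` and parity decides. Otherwise `A` provides an edge `px`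
and `|A| < d` a `J`-neighbour `w ∈ L` of `u`; together they yield an exchange. -/
lemma IsOpt.saturated_one (hJ : IsFringe J A L) (hM : IsOpt J L 1 M) {d : ℕ}
    (hd : ∀ x ∈ L, dg J x = d) (hcard : d + 1 = L.card)
    (h : A.card = 0 ∧ Even L.card ∨ 0 < A.card ∧ A.card < d) : ∀ x ∈ L, dg M x = 1 := by
  intro u hu
  by_contra hne
  have hu0 : dg M u = 0 := by
    have := hM.bound u
    omega
  have huM : ∀ x, ¬ M.Adj u x := fun x hx => by
    have : 0 < dg M u := card_pos.2 ⟨x, mem_nb.2 hx⟩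
    omega
  have tight : ∀ x ∈ L, x ≠ u → ¬ J.Adj u x → (nb M x ∩ A).card = 1 := fun x hx hxu hux =>
    hM.tight_of_isolated hJ (by rw [hd u hu, hcard]) hu hu0 (by simp [hx, hxu, hux])
  have c3 := hJ.card_nb hu
  rw [hd u hu] at c3
  rcases h with ⟨hA, heven⟩ | ⟨hA, hAd⟩
  · rw [Finset.card_eq_zero] at hA
    subst hA
    have h1 : ∀ v, dg M v = if v ∈ L.erase u then 1 else 0 := by
      intro v
      split_ifs with hv
      · rw [mem_erase] at hv
        have huv : J.Adj u v := by
          by_contra h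
          simpa using tight v hv.2 hv.1 h
        exact hM.saturated_L hu (by omega) huv (huM v)
      · rw [mem_erase] at hv
        rcases eq_or_ne v u with rfl | hvu
        · exact hu0
        · rw [dg, Finset.card_eq_zero, eq_empty_iff_forall_notMem]
          intro y hy
          have := hJ.adj v y (hM.le (mem_nb.1 hy))
          have := notMem_empty y
          have := notMem_empty v
          tauto
    have h2 := even_sum_dg M
    rw [sum_congr rfl fun v _ => h1 v, sum_ite_mem, univ_inter, sum_const, smul_eq_mul, mul_one]
      at h2
    have h3 := card_erase_add_one hu
    rw [← h3] at heven
    grind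
  · obtain ⟨p, hp⟩ := card_pos.1 hA
    have hpL := hJ.disj p hp
    have hup : u ≠ p := fun h => hpL (h ▸ hu)
    have hp1 := hM.saturated_A hJ hu (by omega) hp (huM p)
    obtain ⟨x, hx⟩ : (nb M p).Nonempty := card_pos.1 (by change 0 < dg M p; omega)
    have hpx := mem_nb.1 hx
    have hxL : x ∈ L := by
      have := hJ.adj p x (hM.le hpx)
      tauto
    have hxu : x ≠ u := fun h => huM p (h ▸ hpx.symm)
    have hux : ¬ J.Adj u x := fun h => hM.not_adj_A hJ hu (by omega) h (huM x) hp hpx.symm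
    have hxp : ∀ z, M.Adj x z → z = p := fun z hz => by
      have h1 : (nb M x).card ≤ 1 := hM.bound x
      exact card_le_one.1 h1 z (mem_nb.2 hz) p (mem_nb.2 hpx.symm)
    obtain ⟨w, hw⟩ : (L ∩ nb J u).Nonempty := card_pos.1 (by omega)
    rw [mem_inter, mem_nb] at hw
    obtain ⟨hwL, huw⟩ := hw
    have hwx : w ≠ x := fun h => hux (h ▸ huw)
    have hwA : ∀ q ∈ A, ¬ M.Adj w q := fun q hq =>
      hM.not_adj_A hJ hu (by omega) huw (huM w) hq
    -- Moving the edge at `p` from `x` to `u` keeps optimality and isolates `x`, so tightness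
    -- applies at `x` as well.
    have hM1 : IsOpt J L 1 (shift M u p x) := by
      refine ⟨shift_le hM.le (hJ.join u hu p hp), fun v => ?_, fun N hN hNd => ?_⟩
      · have := dg_shift hpx hup (huM p) v
        have := hM.bound v
        grind
      · have := sum_dg_shift hpx hup (huM p) L
        rw [if_pos hxL, if_pos hu] at this
        have := hM.max N hN hNd
        omega
    have hx0 : dg (shift M u p x) x = 0 := by
      have := dg_shift hpx hup (huM p) x
      rw [if_pos rfl, if_neg hxu] at this
      have := hM.bound x
      omega
    have hxw : J.Adj x w := by
      by_contra h
      have h1 := hM1.tight_of_isolated hJ (by rw [hd x hxL, hcard]) hxL hx0 (x := w)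
        (by simp [hwL, hwx, h])
      obtain ⟨q, hq⟩ := card_pos.1 (h1 ▸ one_pos)
      rw [mem_inter, mem_nb, shift_adj hpx hup] at hq
      have := hwA q hq.2
      have := huw.ne
      have : w ≠ p := fun h => hpL (h ▸ hwL)
      tauto
    have hw1 := hM.saturated_L hu (by omega) huw (huM w)
    obtain ⟨y, hy⟩ : (nb M w).Nonempty := card_pos.1 (by change 0 < dg M w; omega)
    have hwy := mem_nb.1 hy
    have hyA : y ∉ A := fun h => hwA y h hwy
    have hyL : y ∈ L := by
      have := hJ.adj w y (hM.le hwy)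
      tauto
    have hyu : y ≠ u := fun h => huM w (h ▸ hwy.symm)
    have huy : J.Adj u y := by
      by_contra h
      have := hM.adj_A_of_tight (tight y hyL hyu h) hwy.symm
      exact hJ.disj w this hwL
    have hyx : y ≠ x := fun h => hux (h ▸ huy)
    have hwp : w ≠ p := fun h => hpL (h ▸ hwL)
    have hwu : w ≠ u := huw.ne'
    have hMwx : ¬ M.Adj w x := fun h => hwp (hxp w h.symm)
    have h1 : (shift M u y w).Adj x p := by
      rw [shift_adj hwy.symm hyu.symm]
      have := hpx.symm
      grind
    have h2 : ¬ (shift M u y w).Adj w x := by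
      rw [shift_adj hwy.symm hyu.symm]
      grind
    -- Trade `wy`, `xp` for `uy`, `wx`: only `p`, outside `L`, loses its edge, and `u` gains one.
    have h3 := hM.max (shift (shift M u y w) w x p) (shift_le (shift_le hM.le huy) hxw.symm)
      fun v => by
        have := dg_shift hwy.symm hyu.symm (huM y) v
        have := dg_shift h1 hwx h2 v
        have := hM.bound v
        grind
    have h4 := sum_dg_shift hwy.symm hyu.symm (huM y) L
    have h5 := sum_dg_shift h1 hwx h2 L
    rw [if_pos hwL, if_pos hu] at h4
    rw [if_neg hpL, if_pos hwL] at h5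
    omega

end

lemma hasFactor_top {k : ℕ} (hk : 2 * k ≤ Fintype.card V + 1)
    (heven : Even (Fintype.card V * k)) : HasFactor (⊤ : SimpleGraph V) k :=
  hasFactor_of_partial (F₀ := ⊥) (X := univ) (B := univ) (fun _ _ _ _ h => h) (subset_univ _)
    (by simp) (by rwa [card_univ]) bot_le (by simp [dg, nb]) (by simp) heven

section

variable {H : SimpleGraph V} {d s k : ℕ} {A B L : Finset V}

lemma IsSplit.card_add (hS : IsSplit H d s A B L) :
    A.card + B.card + s = Fintype.card V := by
  rw [← hS.card, ← card_union_of_disjoint hS.disj_AB, ← card_union_of_disjoint, ← card_univ]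
  · congr 1
    ext x
    have := hS.cover x
    simp only [mem_union, mem_univ, iff_true]
    tauto
  · exact disjoint_union_left.2 ⟨hS.disj_AL, hS.disj_BL⟩

lemma IsSplit.nb_subset (hS : IsSplit H d s A B L) {x : V} (hx : x ∈ L) :
    nb H x ⊆ A ∪ L.erase x := by
  intro y hy
  rw [mem_nb] at hy
  have h1 := hS.cover y
  have h2 : y ∉ B := fun h => hS.nonadj y h x hx hy.symm
  rw [mem_union, mem_erase]
  have := hy.ne'
  tauto

/-- An optimal subgraph of the edges meeting `L` is completed inside the clique off `L`, where `B`
has no neighbours in `L`. -/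
lemma IsSplit.hasFactor_of_saturated (hS : IsSplit H d s A B L)
    (hsat : ∀ J M, IsFringe J A L → (∀ x ∈ L, dg J x = d) → IsOpt J L k M → ∀ x ∈ L, dg M x = k)
    (hB : 2 * k ≤ B.card + 1) (heven : Even (Fintype.card V * k)) : HasFactor H k := by
  let J : SimpleGraph V :=
    { Adj := fun x y => H.Adj x y ∧ (x ∈ L ∨ y ∈ L)
      symm := ⟨fun x y h => ⟨h.1.symm, h.2.symm⟩⟩
      loopless := ⟨fun x h => H.irrefl h.1⟩ }
  have hJH : J ≤ H := fun x y h => h.1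
  have hJ : IsFringe J A L := by
    refine ⟨fun x hx => Finset.disjoint_left.1 hS.disj_AL hx, fun x y hxy => ?_,
      fun x hx y hy => ⟨(hS.join y hy x hx).symm, Or.inl hx⟩⟩
    have h1 := hS.cover x
    have h2 := hS.cover y
    have h3 : x ∈ B → y ∉ L := fun hx hy => hS.nonadj x hx y hy hxy.1
    have h4 : y ∈ B → x ∉ L := fun hy hx => hS.nonadj y hy x hx hxy.1.symm
    have h5 := hxy.2
    tauto
  have hJd : ∀ x ∈ L, dg J x = d := by
    intro x hx
    rw [← hS.degree x hx, dg, dg]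
    congr 1
    ext y
    simp only [mem_nb]
    exact ⟨fun h => h.1, fun h => ⟨h, Or.inl hx⟩⟩
  obtain ⟨M, hM⟩ := exists_isOpt J L k
  refine hasFactor_of_partial (F₀ := M) (X := univ \ L) (B := B) ?_ ?_ ?_ hB (hM.le.trans hJH)
    hM.bound ?_ heven
  · intro x hx y hy hxy
    exact hS.clique x (by simpa using hx) y (by simpa using hy) hxy
  · intro x hx
    simpa using Finset.disjoint_left.1 hS.disj_BL hx
  · intro x hx y hy
    exact hS.nonadj x hx y (by simpa using hy)
  · intro x hx
    exact hsat J M hJ hJd hM x (by simpa using hx)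

end

end

/-! ### The exceptional graphs, and the passage to the closure. -/

section

variable {V : Type*} [Fintype V] [DecidableEq V]

/-- A 1-factor would restrict to a 1-regular graph on the odd set `S`. -/
lemma not_hasFactor_one_of_odd {H : SimpleGraph V} {S : Finset V}
    (hS : ∀ x ∈ S, ∀ y, H.Adj x y → y ∈ S) (hodd : ¬ Even S.card) : ¬ HasFactor H 1 := by
  rw [hasFactor_iff]
  rintro ⟨F, hF, hd⟩
  let F' : SimpleGraph V :=
    { Adj := fun x y => F.Adj x y ∧ x ∈ S ∧ y ∈ S
      symm := ⟨fun x y h => ⟨h.1.symm, h.2.2, h.2.1⟩⟩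
      loopless := ⟨fun x h => F.irrefl h.1⟩ }
  have h1 : ∀ v, dg F' v = if v ∈ S then 1 else 0 := by
    intro v
    split_ifs with hv
    · rw [← hd v, dg, dg]
      congr 1
      ext y
      simp only [mem_nb]
      exact ⟨fun h => h.1, fun h => ⟨h, hv, hS v hv y (hF h)⟩⟩
    · rw [dg, Finset.card_eq_zero, eq_empty_iff_forall_notMem]
      exact fun y hy => hv (mem_nb.1 hy).2.1
  have h2 := even_sum_dg F'
  rw [sum_congr rfl fun v _ => h1 v, sum_ite_mem, univ_inter, sum_const, smul_eq_mul, mul_one]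
    at h2
  exact hodd h2

lemma not_hasFactor_one_of_card_lt {H : SimpleGraph V} {S T : Finset V}
    (hS : ∀ x ∈ S, ∀ y, H.Adj x y → y ∈ T) (hcard : T.card < S.card) : ¬ HasFactor H 1 := by
  rw [hasFactor_iff]
  rintro ⟨F, hF, hd⟩
  have h1 : ∑ x ∈ S, (nb F x ∩ T).card = S.card := by
    rw [card_eq_sum_ones]
    refine sum_congr rfl fun x hx => ?_
    rw [inter_eq_left.2 fun y hy => hS x hx y (hF (mem_nb.1 hy))]
    exact hd x
  have h2 : ∑ y ∈ T, (nb F y ∩ S).card ≤ T.card := by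
    rw [card_eq_sum_ones]
    exact sum_le_sum fun y _ => (card_le_card inter_subset_left).trans (hd y).le
  rw [sum_card_nb_inter] at h1
  omega

lemma not_hasFactor_one_of_iso_union {H : SimpleGraph V} {n δ : ℕ} (hδ : Even δ)
    (e : H ≃g exceptionalUnion n δ) : ¬ HasFactor H 1 := by
  refine not_hasFactor_one_of_odd
    (S := univ.image fun i : Fin (δ + 1) => e.symm (Sum.inr i)) ?_ ?_
  · intro x hx y hxy
    obtain ⟨i, -, rfl⟩ := mem_image.1 hx
    rw [← e.map_adj_iff, e.apply_symm_apply] at hxy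
    rcases h : e y with j | j
    · rw [h] at hxy
      simp at hxy
    · exact mem_image.2 ⟨j, mem_univ _, by rw [← h, e.symm_apply_apply]⟩
  · rw [card_image_of_injective _ fun i j h => Sum.inr_injective (e.symm.injective h), card_univ,
      Fintype.card_fin]
    exact Nat.not_even_iff_odd.2 hδ.add_one

lemma not_hasFactor_one_of_iso_join {H : SimpleGraph V} {n δ : ℕ}
    (e : H ≃g exceptionalJoin n δ) : ¬ HasFactor H 1 := by
  refine not_hasFactor_one_of_card_lt
    (S := univ.image fun i : Fin (δ + 1) => e.symm (Sum.inr (Sum.inr i)))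
    (T := univ.image fun i : Fin δ => e.symm (Sum.inl i)) ?_ ?_
  · intro x hx y hxy
    obtain ⟨i, -, rfl⟩ := mem_image.1 hx
    rw [← e.map_adj_iff, e.apply_symm_apply] at hxy
    rcases h : e y with j | j | j
    · exact mem_image.2 ⟨j, mem_univ _, by rw [← h, e.symm_apply_apply]⟩
    · rw [h] at hxy
      simp [graphJoin] at hxy
    · rw [h] at hxy
      simp [graphJoin] at hxy
  · rw [card_image_of_injective _ fun i j h =>
        Sum.inr_injective (Sum.inr_injective (e.symm.injective h)),
      card_image_of_injective _ fun i j h => Sum.inl_injective (e.symm.injective h)]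
    simp

section

variable {H : SimpleGraph V} {n δ : ℕ} {A B L : Finset V}

/-- With `A` empty, degree `δ = |L| - 1` makes `L` a clique. -/
lemma IsSplit.nonempty_iso_union (hS : IsSplit H δ (δ + 1) A B L) (hn : Fintype.card V = n)
    (hA : A.card = 0) : Nonempty (H ≃g exceptionalUnion n δ) := by
  have hcard := hS.card_add
  rw [Finset.card_eq_zero] at hA
  subst hA
  have hBc : B.card = n - δ - 1 := by
    simp at hcard
    omega
  have hadj : ∀ x ∈ L, ∀ y ∈ L, x ≠ y → H.Adj x y := by
    intro x hx y hy hxy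
    have h1 := hS.nb_subset hx
    rw [empty_union] at h1
    have h2 : nb H x = L.erase x := by
      refine eq_of_subset_of_card_le h1 ?_
      rw [card_erase_of_mem hx, hS.card]
      exact (hS.degree x hx).ge
    rw [← mem_nb, h2]
    exact mem_erase.2 ⟨hxy.symm, hy⟩
  let f := (B.equivFinOfCardEq hBc).symm
  let g := (L.equivFinOfCardEq hS.card).symm
  have hBL := Finset.disjoint_left.1 hS.disj_BL
  have hfL : ∀ i, (f i : V) ∉ L := fun i => hBL (f i).2
  have hfg : ∀ i j, (f i : V) ≠ g j := fun i j h => hfL i (h ▸ (g j).2)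
  let φ : Fin (n - δ - 1) ⊕ Fin (δ + 1) → V := Sum.elim (fun i => f i) (fun i => g i)
  have hφ : Function.Bijective φ := by
    constructor
    · rintro (i | i) (j | j) h
      · simpa [φ, Subtype.coe_inj] using h
      · exact absurd h (hfg i j)
      · exact absurd h.symm (hfg j i)
      · simpa [φ, Subtype.coe_inj] using h
    · intro x
      rcases hS.cover x with hx | hx | hx
      · simp at hx
      · exact ⟨Sum.inl (f.symm ⟨x, hx⟩), by simp [φ]⟩
      · exact ⟨Sum.inr (g.symm ⟨x, hx⟩), by simp [φ]⟩
  refine ⟨(RelIso.symm ⟨Equiv.ofBijective φ hφ, ?_⟩)⟩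
  rintro (i | i) (j | j)
  · have : H.Adj (f i) (f j) ↔ i ≠ j :=
      ⟨fun h e => h.ne (by rw [e]), fun h => hS.clique _ (hfL i) _ (hfL j)
        fun e => h (f.injective (Subtype.ext e))⟩
    simpa [φ] using this
  · have : ¬ H.Adj (f i) (g j) := hS.nonadj _ (f i).2 _ (g j).2
    simpa [φ] using this
  · have : ¬ H.Adj (g i) (f j) := fun h => hS.nonadj _ (f j).2 _ (g i).2 h.symm
    simpa [φ] using this
  · have : H.Adj (g i) (g j) ↔ i ≠ j :=
      ⟨fun h e => h.ne (by rw [e]), fun h => hadj _ (g i).2 _ (g j).2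
        fun e => h (g.injective (Subtype.ext e))⟩
    simpa [φ] using this

/-- The `δ` vertices of `A` exhaust the degrees in `L`, so `L` is independent. -/
lemma IsSplit.nonempty_iso_join (hS : IsSplit H δ (δ + 1) A B L) (hn : Fintype.card V = n)
    (hA : A.card = δ) : Nonempty (H ≃g exceptionalJoin n δ) := by
  have hcard := hS.card_add
  have hBc : B.card = n - 2 * δ - 1 := by omega
  have hAL := Finset.disjoint_left.1 hS.disj_AL
  have hAB := Finset.disjoint_left.1 hS.disj_AB
  have hBL := Finset.disjoint_left.1 hS.disj_BL
  have hnadj : ∀ x ∈ L, ∀ y ∈ L, ¬ H.Adj x y := by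
    intro x hx y hy hxy
    have h1 : A ⊆ nb H x := fun a ha => mem_nb.2 (hS.join a ha x hx).symm
    have h2 : A = nb H x := by
      refine eq_of_subset_of_card_le h1 ?_
      rw [hA]
      exact (hS.degree x hx).le
    exact hAL (h2 ▸ mem_nb.2 hxy) hy
  let a := (A.equivFinOfCardEq hA).symm
  let f := (B.equivFinOfCardEq hBc).symm
  let g := (L.equivFinOfCardEq hS.card).symm
  have haL : ∀ i, (a i : V) ∉ L := fun i => hAL (a i).2
  have hfL : ∀ i, (f i : V) ∉ L := fun i => hBL (f i).2
  have hfg : ∀ i j, (f i : V) ≠ g j := fun i j h => hfL i (h ▸ (g j).2)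
  have hag : ∀ i j, (a i : V) ≠ g j := fun i j h => haL i (h ▸ (g j).2)
  have haf : ∀ i j, (a i : V) ≠ f j := fun i j h => hAB (a i).2 (h ▸ (f j).2)
  let φ : Fin δ ⊕ (Fin (n - 2 * δ - 1) ⊕ Fin (δ + 1)) → V :=
    Sum.elim (fun i => a i) (Sum.elim (fun i => f i) (fun i => g i))
  have hφ : Function.Bijective φ := by
    constructor
    · rintro (i | i | i) (j | j | j) h
      · simpa [φ, Subtype.coe_inj] using h
      · exact absurd h (haf i j)
      · exact absurd h (hag i j)
      · exact absurd h.symm (haf j i)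
      · simpa [φ, Subtype.coe_inj] using h
      · exact absurd h (hfg i j)
      · exact absurd h.symm (hag j i)
      · exact absurd h.symm (hfg j i)
      · simpa [φ, Subtype.coe_inj] using h
    · intro x
      rcases hS.cover x with hx | hx | hx
      · exact ⟨Sum.inl (a.symm ⟨x, hx⟩), by simp [φ]⟩
      · exact ⟨Sum.inr (Sum.inl (f.symm ⟨x, hx⟩)), by simp [φ]⟩
      · exact ⟨Sum.inr (Sum.inr (g.symm ⟨x, hx⟩)), by simp [φ]⟩
  refine ⟨(RelIso.symm ⟨Equiv.ofBijective φ hφ, ?_⟩)⟩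
  rintro (i | i | i) (j | j | j)
  · have : H.Adj (a i) (a j) ↔ i ≠ j :=
      ⟨fun h e => h.ne (by rw [e]), fun h => hS.clique _ (haL i) _ (haL j)
        fun e => h (a.injective (Subtype.ext e))⟩
    simpa [φ, graphJoin] using this
  · have : H.Adj (a i) (f j) := hS.clique _ (haL i) _ (hfL j) (haf i j)
    simpa [φ, graphJoin] using this
  · have : H.Adj (a i) (g j) := hS.join _ (a i).2 _ (g j).2
    simpa [φ, graphJoin] using this
  · have : H.Adj (f i) (a j) := hS.clique _ (hfL i) _ (haL j) (haf j i).symm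
    simpa [φ, graphJoin] using this
  · have : H.Adj (f i) (f j) ↔ i ≠ j :=
      ⟨fun h e => h.ne (by rw [e]), fun h => hS.clique _ (hfL i) _ (hfL j)
        fun e => h (f.injective (Subtype.ext e))⟩
    simpa [φ, graphJoin] using this
  · have : ¬ H.Adj (f i) (g j) := hS.nonadj _ (f i).2 _ (g j).2
    simpa [φ, graphJoin] using this
  · have : H.Adj (g i) (a j) := (hS.join _ (a j).2 _ (g i).2).symm
    simpa [φ, graphJoin] using this
  · have : ¬ H.Adj (g i) (f j) := fun h => hS.nonadj _ (f j).2 _ (g i).2 h.symm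
    simpa [φ, graphJoin] using this
  · have : ¬ H.Adj (g i) (g j) := hnadj _ (g i).2 _ (g j).2
    simpa [φ, graphJoin] using this

end

/-- A graph with many cliques and without a `k`-factor has a closure that splits. -/
lemma exists_isSplit_lClosure {G : SimpleGraph V} [DecidableRel G.Adj] {n r k δ : ℕ}
    (hr : 2 ≤ r) (hk : 1 ≤ k) (hn : Fintype.card V = n) (hnδ : 2 * δ + k + 1 ≤ n)
    (hnk : Even (n * k)) (hδ : δ ≤ G.minDegree) (hc : 2 * k - 3 < δ)
    (hN : max (bnd n r (2 * k - 3) (δ + 1)) (bnd n r (2 * k - 3) ((n - 2 + (2 * k - 3)) / 2)) <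
      (G.cliqueFinset r).card) (hG : ¬ HasFactor G k) :
    ∃ A B L, IsSplit (lClosure (n - 1 + (2 * k - 3)) G) δ (δ + 1 - (2 * k - 3)) A B L := by
  classical
  subst hn
  have hle := le_lClosure (Fintype.card V - 1 + (2 * k - 3)) G
  have hfac : ¬ HasFactor (lClosure (Fintype.card V - 1 + (2 * k - 3)) G) k :=
    fun h => hG (hasFactor_of_lClosure hk h)
  refine exists_isSplit rfl hr hc.le (by omega) (fun v => ?_)
    (fun u v huv h => lClosure_closed huv h) (hN.trans_le (cliqueFinset_card_mono hle r)) ?_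
  · have := hδ.trans (G.minDegree_le_degree v)
    rw [degree_eq_dg] at this
    exact this.trans (dg_mono hle v)
  · intro htop
    rw [htop] at hfac
    exact hfac (hasFactor_top (by omega) hnk)

lemma phiOne_eq_bnd (n r q : ℕ) : phiOne n r q = bnd n r (2 * 1 - 3) q := by
  simp [phiOne, bnd, Nat.sub_sub]

lemma phiTwo_eq_bnd {n r k q : ℕ} (hk : 2 ≤ k) (hq : 2 * k ≤ q + 4) :
    phiTwo n r k q = bnd n r (2 * k - 3) q := by
  have h1 : n + 2 * k - 4 - q = n - (q + 1 - (2 * k - 3)) := by omega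
  have h2 : q + 4 - 2 * k = q + 1 - (2 * k - 3) := by omega
  rw [phiTwo, bnd, h1, h2]

end

end KFactor

/-! ### The main theorem. -/

theorem theorem1p3 {V : Type*} [Fintype V] [DecidableEq V] (G : SimpleGraph V)
    [DecidableRel G.Adj] (n r k δ : ℕ) (hr : 2 ≤ r) (hk : 1 ≤ k)
    (hn : Fintype.card V = n) (hnδ : 2 * δ + k + 1 ≤ n) (hnk : Even (n * k))
    (hδ : δ ≤ G.minDegree) :
    -- (i); for `k = 1` the parity condition `Even n` is `hnk`
    (Even n → 1 ≤ δ → δ ≤ n / 2 - 1 →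
      max (KFactor.phiOne n r (δ + 1)) (KFactor.phiOne n r (n / 2 - 1)) <
        (G.cliqueFinset r).card →
      (KFactor.HasFactor G 1 ↔
        ¬ ((Even δ ∧ Nonempty (KFactor.lClosure (n - 1) G ≃g KFactor.exceptionalUnion n δ)) ∨
          Nonempty (KFactor.lClosure (n - 1) G ≃g KFactor.exceptionalJoin n δ)))) ∧
    -- (ii)
    (2 ≤ k → 2 * k - 2 ≤ δ → δ ≤ (n + 2 * k - 5) / 2 →
      max (KFactor.phiTwo n r k (δ + 1)) (KFactor.phiTwo n r k ((n + 2 * k - 5) / 2)) <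
        (G.cliqueFinset r).card →
      KFactor.HasFactor G k) := by
  constructor
  · intro hev h1 _ hN
    constructor
    · intro hG hex
      have hC : KFactor.HasFactor (KFactor.lClosure (n - 1) G) 1 := by
        obtain ⟨F, hF, hd⟩ := hG
        exact ⟨F, hF.trans (KFactor.le_lClosure _ _), hd⟩
      rcases hex with ⟨hδe, ⟨e⟩⟩ | ⟨⟨e⟩⟩
      · exact KFactor.not_hasFactor_one_of_iso_union hδe e hC
      · exact KFactor.not_hasFactor_one_of_iso_join e hC
    · intro hex
      by_contra hG
      rw [KFactor.phiOne_eq_bnd, KFactor.phiOne_eq_bnd,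
        show n / 2 - 1 = (n - 2 + (2 * 1 - 3)) / 2 by omega] at hN
      obtain ⟨A, B, L, hS⟩ := KFactor.exists_isSplit_lClosure hr le_rfl hn (by omega)
        (by simpa using hev) hδ (by omega) hN hG
      simp only [show 2 * 1 - 3 = 0 from rfl, add_zero, Nat.sub_zero] at hS
      have hcard := hS.card_add
      have hA := hS.card_A
      refine hG (KFactor.hasFactor_of_lClosure le_rfl ?_)
      simp only [show 2 * 1 - 3 = 0 from rfl, add_zero, hn]
      refine hS.hasFactor_of_saturated (fun J M hJ hJd hM => ?_) (by omega)
        (by simpa [hn] using hev)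
      refine hM.saturated_one hJ hJd hS.card.symm ?_
      rcases Nat.eq_zero_or_pos A.card with hA0 | hA0
      · refine Or.inl ⟨hA0, ?_⟩
        by_contra hL
        rw [hS.card, Nat.even_add_one, not_not] at hL
        exact hex (Or.inl ⟨hL, hS.nonempty_iso_union hn hA0⟩)
      · refine Or.inr ⟨hA0, lt_of_le_of_ne hA fun hAδ => ?_⟩
        exact hex (Or.inr (hS.nonempty_iso_join hn hAδ))
  · intro hk2 h1 _ hN
    by_contra hG
    rw [KFactor.phiTwo_eq_bnd hk2 (by omega),
      KFactor.phiTwo_eq_bnd hk2 (by omega),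
      show (n + 2 * k - 5) / 2 = (n - 2 + (2 * k - 3)) / 2 by
        congr 1; omega] at hN
    obtain ⟨A, B, L, hS⟩ := KFactor.exists_isSplit_lClosure hr hk hn hnδ hnk hδ (by omega) hN hG
    have hcard := hS.card_add
    have hA := hS.card_A
    have hL := hS.card
    subst hn
    refine hG (KFactor.hasFactor_of_lClosure hk ?_)
    -- Here `|L| = δ + 4 - 2k ≥ 2`, and `|A| ≤ δ` leaves `|B| ≥ 3k - 3 ≥ 2k - 1`.
    exact hS.hasFactor_of_saturated (fun J M hJ hJd hM =>
      hM.saturated_of_two_le hJ hk2 hJd (by omega) (by omega)) (by omega) hnk
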